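/- Let $n,m\in\mathbb N$. For a complex $n\times m$ matrix $A=(a_{ij})$ put $|A\rangle\!\rangle=\sum_{i,j}a_{ij}\,|i\rangle\otimes|j\rangle\in\mathbb C^n\otimes\mathbb C^m$ (Alice holds the first factor, Bob the second). Let $A,B$ be $n\times m$ matrices such that $|A\rangle\!\rangle$ and $|B\rangle\!\rangle$ are unit vectors, and let $0\le p\le 1$. *Majorization.* For $x,y\in\mathbb R^n$, with entries rearranged in decreasing order $x^\downarrow_1\ge\dots\ge x^\downarrow_n$, write $x\prec_w y$ (submajorization) if $\sum_{i\le l}x_i^\downarrow\le\sum_{i\le l}y_i^\downarrow$ for all $l$; $x\prec^w y$ (supermajorization) if $\sum_{i\ge l}x_i^\downarrow\ge\sum_{i\ge l}y_i^\downarrow$ for all $l$; and $x\prec y$ if $x\prec_w y$ and $\sum_i x_i=\sum_i y_i$. For Hermitian matrices these relations refer to the vectors of eigenvalues (with multiplicity). *LOCC.* An LOCC protocol consists of finitely many rounds. In each round one party performs on its own system a measurement with finitely many outcomes $\lambda$, given by operators $M_\lambda$ with $\sum_\lambda M_\lambda^\dagger M_\lambda=I$, which maps the (unnormalized) joint vector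 $\psi$ to $(M_\lambda\otimes I)\psi$ or $(I\otimes M_\lambda)\psi$; all that follows may depend on the outcomes obtained so far. (The dimension of the local system may change with the outcome, as when ancillas are added or discarded; a protocol has *fixed spaces* if all $M_\lambda$ are square.) The transformation $|A\rangle\!\rangle\to|B\rangle\!\rangle$ is achieved by LOCC with probability $p$ if some protocol started in $|A\rangle\!\rangle$ has a set of terminal branches, of total probability $p$, on each of which the final vector lies in $\mathbb C^n\otimes\mathbb C^m$ and is a scalar multiple of $|B\rangle\!\rangle$ (the probability of a branch is the squared norm of its final vector). It is achieved with probability $p$ by a *pure* LOCC if $(M\otimes U)|A\rangle\!\rangle=\sqrt p\,|B\rangle\!\rangle$ for one of the operators $M$ of some measurement of Alice on $\mathbb C^n$ and some unitary $U$ of Bob on $\mathbb C^m$. Then: 1. $|A\rangle\!\rangle\to|B\rangle\!\rangle$ can be achieved by LOCC with probability $p$ if and only if $AA^\dagger\prec^w p\,BB^\dagger$. 2. If $p>0$ and $|A\rangle\!\rangle\to|B\rangle\!\rangle$ can be achieved by LOCC with probability $p$, then $\operatorname{rank}(A)\ge\operatorname{rank}(B)$. 3. $|A\rangle\!\rangle\to|B\rangle\!\rangle$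 can be achieved by LOCC deterministically (with probability $1$) if and only if $AA^\dagger\prec BB^\dagger$. 4. If $|A\rangle\!\rangle\to|B\rangle\!\rangle$ can be achieved with probability $p$ by a pure LOCC, then $p\,BB^\dagger\prec_w AA^\dagger$. Statements 1 and 3 hold both for arbitrary LOCC protocols and for those with fixed spaces. -/

import Mathlib

open scoped Kronecker Matrix

noncomputable section

namespace PureLOCC

/-! ### Majorization -/

/-- The entries of `x` rearranged in decreasing order. -/
def decr {n : ℕ} (x : Fin n → ℝ) : Fin n → ℝ :=
  fun i => x (Tuple.sort x (Fin.rev i))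

/-- Submajorization `x ≺_w y`: for every `l`, the sum of the `l` largest entries of `x` is at most
the sum of the `l` largest entries of `y`. -/
def VecSubmajorized {n : ℕ} (x y : Fin n → ℝ) : Prop :=
  ∀ l : ℕ, ∑ i : Fin n with i.val < l, decr x i ≤ ∑ i : Fin n with i.val < l, decr y i

/-- Supermajorization `x ≺^w y`: for every `l`, deleting the `l` largest entries of `x` and of `y`,
the remaining entries of `x` have sum at least the sum of the remaining entries of `y`. -/
def VecSupermajorized {n : ℕ} (x y : Fin n → ℝ) : Prop :=
  ∀ l : ℕ, ∑ i : Fin n with l ≤ i.val, decr y i ≤ ∑ i : Fin n with l ≤ i.val, decr x i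

/-- Majorization `x ≺ y`. -/
def VecMajorized {n : ℕ} (x y : Fin n → ℝ) : Prop :=
  VecSubmajorized x y ∧ ∑ i, x i = ∑ i, y i

/-- `X ≺ Y` for Hermitian matrices: majorization of the vectors of eigenvalues. -/
def Majorized {n : ℕ} (X Y : Matrix (Fin n) (Fin n) ℂ) : Prop :=
  ∃ (hX : X.IsHermitian) (hY : Y.IsHermitian), VecMajorized hX.eigenvalues hY.eigenvalues

/-- `X ≺^w Y` for Hermitian matrices. -/
def Supermajorized {n : ℕ} (X Y : Matrix (Fin n) (Fin n) ℂ) : Prop :=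
  ∃ (hX : X.IsHermitian) (hY : Y.IsHermitian), VecSupermajorized hX.eigenvalues hY.eigenvalues

/-- `X ≺_w Y` for Hermitian matrices. -/
def Submajorized {n : ℕ} (X Y : Matrix (Fin n) (Fin n) ℂ) : Prop :=
  ∃ (hX : X.IsHermitian) (hY : Y.IsHermitian), VecSubmajorized hX.eigenvalues hY.eigenvalues

/-! ### Bipartite vectors -/

/-- The vector `|A⟩⟩ = ∑ i j, A i j |i⟩ ⊗ |j⟩` of `ℂⁿ ⊗ ℂᵐ`, in coordinates with respect to the
product basis. -/
def ket {n m : ℕ} (A : Matrix (Fin n) (Fin m) ℂ) : Fin n × Fin m → ℂ :=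
  fun x => A x.1 x.2

/-- The squared Hilbert space norm. -/
def normSq {n m : ℕ} (ψ : Fin n × Fin m → ℂ) : ℝ :=
  ∑ x, ‖ψ x‖ ^ 2

/-- Unit vectors, i.e. pure states. -/
def IsState {n m : ℕ} (ψ : Fin n × Fin m → ℂ) : Prop :=
  normSq ψ = 1

/-! ### LOCC protocols -/

/-- Finite LOCC protocols (trees) that start with Alice holding a system of dimension `a` and Bob
a system of dimension `b`, and that aim at a state of `ℂᴺ ⊗ ℂᴹ`. In each round one of the parties
performs a measurement with finitely many outcomes `i`, described by operators `K i` with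
`∑ i, (K i)ᴴ * K i = 1` (the system after outcome `i` may have a new dimension `d i`, which covers
adding and discarding of local ancillas, while one-outcome measurements cover local unitaries);
the outcome is communicated, and the rest of the protocol may depend on it. Every terminal branch
is declared either a success (`accept`) or a failure (`abort`). -/
inductive Protocol (N M : ℕ) : ℕ → ℕ → Type
  | abort {a b : ℕ} : Protocol N M a b
  | accept : Protocol N M N M
  | alice {a b k : ℕ} (d : Fin k → ℕ) (K : (i : Fin k) → Matrix (Fin (d i)) (Fin a) ℂ)
      (complete : ∑ i, (K i)ᴴ * K i = 1) (next : (i : Fin k) → Protocol N M (d i) b) :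
      Protocol N M a b
  | bob {a b k : ℕ} (d : Fin k → ℕ) (K : (i : Fin k) → Matrix (Fin (d i)) (Fin b) ℂ)
      (complete : ∑ i, (K i)ᴴ * K i = 1) (next : (i : Fin k) → Protocol N M a (d i)) :
      Protocol N M a b

namespace Protocol

variable {N M : ℕ}

/-- Started in the (possibly unnormalized) vector `ψ`, the protocol reaches on each of its accepted
branches the state `φ` (up to a phase; the vector reached on a branch is not normalized, its
squared norm is the probability of the branch). -/
def Produces (φ : Fin N × Fin M → ℂ) :
    {a b : ℕ} → Protocol N M a b → (Fin a × Fin b → ℂ) → Prop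
  | _, _, abort, _ => True
  | _, _, accept, ψ => ∃ c : ℂ, ψ = c • φ
  | _, b, alice _ K _ next, ψ =>
      ∀ i, (next i).Produces φ ((K i ⊗ₖ (1 : Matrix (Fin b) (Fin b) ℂ)) *ᵥ ψ)
  | a, _, bob _ K _ next, ψ =>
      ∀ i, (next i).Produces φ (((1 : Matrix (Fin a) (Fin a) ℂ) ⊗ₖ K i) *ᵥ ψ)

/-- The total probability of the accepted branches, when the protocol is started in `ψ`. -/
def successProb : {a b : ℕ} → Protocol N M a b → (Fin a × Fin b → ℂ) → ℝ
  | _, _, abort, _ => 0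
  | _, _, accept, ψ => normSq ψ
  | _, b, alice _ K _ next, ψ =>
      ∑ i, (next i).successProb ((K i ⊗ₖ (1 : Matrix (Fin b) (Fin b) ℂ)) *ᵥ ψ)
  | a, _, bob _ K _ next, ψ =>
      ∑ i, (next i).successProb (((1 : Matrix (Fin a) (Fin a) ℂ) ⊗ₖ K i) *ᵥ ψ)

/-- All measurement operators of the protocol are square: the local spaces are never changed. -/
def FixedSpaces : {a b : ℕ} → Protocol N M a b → Prop
  | _, _, abort => True
  | _, _, accept => True
  | a, _, alice d _ _ next => ∀ i, d i = a ∧ (next i).FixedSpaces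
  | _, b, bob d _ _ next => ∀ i, d i = b ∧ (next i).FixedSpaces

end Protocol

/-- `|A⟩⟩ → |B⟩⟩` can be achieved by LOCC with probability `p`. -/
def LOCCTransforms {n m : ℕ} (A B : Matrix (Fin n) (Fin m) ℂ) (p : ℝ) : Prop :=
  ∃ P : Protocol n m n m, P.Produces (ket B) (ket A) ∧ P.successProb (ket A) = p

/-- `|A⟩⟩ → |B⟩⟩` can be achieved with probability `p` by LOCC whose measurement operators act
within the two given local spaces. -/
def FixedLOCCTransforms {n m : ℕ} (A B : Matrix (Fin n) (Fin m) ℂ) (p : ℝ) : Prop :=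
  ∃ P : Protocol n m n m,
    P.FixedSpaces ∧ P.Produces (ket B) (ket A) ∧ P.successProb (ket A) = p

/-- `|A⟩⟩ → |B⟩⟩` can be achieved with probability `p` by a pure LOCC: one single outcome of one
measurement of Alice, with a corresponding unitary of Bob. -/
def PureLOCCTransforms {n m : ℕ} (A B : Matrix (Fin n) (Fin m) ℂ) (p : ℝ) : Prop :=
  ∃ (k : ℕ) (K : Fin k → Matrix (Fin n) (Fin n) ℂ) (i : Fin k),
    ∑ j, (K j)ᴴ * K j = 1 ∧
    ∃ U ∈ Matrix.unitaryGroup (Fin m) ℂ, (K i ⊗ₖ U) *ᵥ ket A = ((√p : ℝ) : ℂ) • ket B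

end PureLOCC

end

/-!
Write a vector of `ℂⁿ ⊗ ℂᵐ` as `|X⟩⟩`; then operators `K` of Alice and `L` of Bob turn it into
`|K * X * Lᵀ⟩⟩`, and `X * Xᴴ` is Alice's (unnormalized) reduced state.

*Necessity.* By the Eckart–Young theorem, the sum of the eigenvalues of `X * Xᴴ` except the `l`
largest ones is the minimal squared distance from `X` to a matrix `Z` of rank at most `l`
(`sum_decr_eigenvalues_le_normSq_sub`, `exists_rank_le_normSq_sub_eq`). A measurement applied to
`X - Z` preserves the total squared norm and does not increase the rank of `Z`, so this distance
does not increase on average in a round of a protocol, whatever the intermediate dimensions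
(`Protocol.successProb_mul_le_normSq_sub`). Comparing the start `A` with the accepted branches, all
of them multiples of `B`, gives `A * Aᴴ ≺^w p • (B * Bᴴ)`. The rank is likewise monotone along each
branch.

*Sufficiency.* Let `x` and `z` be the eigenvalues of `A * Aᴴ` and of `p • (B * Bᴴ)`. If `x ≺^w z`,
then `x` dominates entrywise an average `∑ σ, q σ * z ∘ σ` of the permutations of `z`
(`VecSupermajorized.exists_average_perm_le`): the vectors with this property form a closed convex
set, and by the rearrangement inequality and Abel summation no functional separates `x` from it.
Alice measures with one operator for each permutation `σ`, which sends the `i`-th eigenvector of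
`A * Aᴴ` to the eigenvector `σ i` of `p • (B * Bᴴ)` scaled by `√(q σ * z (σ i) / x i)`; one more
outcome, the failure, completes the measurement. After outcome `σ` her reduced state is
`(q σ * p) • (B * Bᴴ)`, and Bob reaches a multiple of `|B⟩⟩` by a unitary
(`exists_unitary_mul_transpose_eq`).

The deterministic case is the case `p = 1`, in which the traces agree. For pure transformations,
`p • (B * Bᴴ) = (K * A) * (K * A)ᴴ` with a contraction `K`, which does not increase the sums of the
largest eigenvalues (`vecSubmajorized_of_measurement`).
-/

namespace PureLOCC

/-! ### Decreasing rearrangements and partial sums -/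

/-- The permutation that lists the entries of `x` in decreasing order. -/
noncomputable def decrPerm {n : ℕ} (x : Fin n → ℝ) : Equiv.Perm (Fin n) :=
  Fin.revPerm.trans (Tuple.sort x)

lemma decr_eq {n : ℕ} (x : Fin n → ℝ) (i : Fin n) : decr x i = x (decrPerm x i) := rfl

lemma decr_antitone {n : ℕ} (x : Fin n → ℝ) : Antitone (decr x) := fun _ _ h =>
  Tuple.monotone_sort x (Fin.rev_le_rev.mpr h)

lemma sum_decr {n : ℕ} (x : Fin n → ℝ) : ∑ i, decr x i = ∑ i, x i :=
  Equiv.sum_comp (decrPerm x) x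

lemma sum_decr_lt_add_sum_decr_ge {n : ℕ} (x : Fin n → ℝ) (l : ℕ) :
    ∑ i : Fin n with i.val < l, decr x i + ∑ i : Fin n with l ≤ i.val, decr x i = ∑ i, x i := by
  rw [← sum_decr, ← Finset.sum_filter_add_sum_filter_not Finset.univ (fun i : Fin n => i.val < l)]
  simp

/-- The sum of the `l` largest entries bounds every weighted sum of the entries with weights in
`[0, 1]` of total at most `l`. -/
lemma sum_mul_le_sum_decr {n : ℕ} (x w : Fin n → ℝ) (l : ℕ) (hx : ∀ i, 0 ≤ x i)
    (hw0 : ∀ i, 0 ≤ w i) (hw1 : ∀ i, w i ≤ 1) (hw : ∑ i, w i ≤ l) :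
    ∑ i, w i * x i ≤ ∑ i : Fin n with i.val < l, decr x i := by
  rw [← Equiv.sum_comp (decrPerm x) (fun i => w i * x i)]
  rw [← Equiv.sum_comp (decrPerm x)] at hw
  simp only [← decr_eq]
  rw [Finset.sum_filter]
  by_cases hl : n ≤ l
  · apply Finset.sum_le_sum
    intro i _
    rw [if_pos (by omega)]
    exact mul_le_of_le_one_left (hx _) (hw1 _)
  · push Not at hl
    have hc : 0 ≤ decr x ⟨l, hl⟩ := hx _
    have hcard : ∑ i : Fin n, (if i.val < l then (1 : ℝ) else 0) = l := by
      rw [← Finset.sum_filter, Finset.sum_const, nsmul_eq_mul, mul_one, Nat.cast_inj]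
      simp [Fin.card_filter_val_lt, hl.le]
    -- compare both sides with the threshold entry of index `l`
    have key : ∀ i : Fin n, (w (decrPerm x i) - if i.val < l then 1 else 0) *
        (decr x i - decr x ⟨l, hl⟩) ≤ 0 := by
      intro i
      by_cases hi : i.val < l
      · have := decr_antitone x (show i ≤ ⟨l, hl⟩ from hi.le)
        have := hw1 (decrPerm x i)
        rw [if_pos hi]
        exact mul_nonpos_of_nonpos_of_nonneg (by linarith) (by linarith)
      · have := decr_antitone x (show ⟨l, hl⟩ ≤ i from not_lt.mp hi)
        have := hw0 (decrPerm x i)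
        rw [if_neg hi]
        exact mul_nonpos_of_nonneg_of_nonpos (by linarith) (by linarith)
    have h1 := Finset.sum_nonpos (fun i (_ : i ∈ Finset.univ) => key i)
    have h2 : ∑ i : Fin n, (w (decrPerm x i) - if i.val < l then 1 else 0) *
        (decr x i - decr x ⟨l, hl⟩) = ∑ i, w (decrPerm x i) * decr x i
        - ∑ i : Fin n, (if i.val < l then decr x i else 0)
        - (∑ i, w (decrPerm x i) - l) * decr x ⟨l, hl⟩ := by
      rw [← hcard, ← Finset.sum_sub_distrib, ← Finset.sum_sub_distrib, Finset.sum_mul,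
        ← Finset.sum_sub_distrib]
      refine Finset.sum_congr rfl fun i _ => ?_
      split_ifs <;> ring
    nlinarith [mul_nonneg (sub_nonneg.mpr hw) hc]

/-- What remains after deleting the `l` largest entries is at most every weighted sum of the
entries with weights in `[0, 1]` of total at least `n - l`. -/
lemma sum_decr_le_sum_mul {n : ℕ} (x w : Fin n → ℝ) (l : ℕ) (hx : ∀ i, 0 ≤ x i)
    (hw0 : ∀ i, 0 ≤ w i) (hw1 : ∀ i, w i ≤ 1) (hw : (n : ℝ) ≤ ∑ i, w i + l) :
    ∑ i : Fin n with l ≤ i.val, decr x i ≤ ∑ i, w i * x i := by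
  have h := sum_mul_le_sum_decr x (fun i => 1 - w i) l hx (fun i => by linarith [hw1 i])
    (fun i => by linarith [hw0 i]) (by simp; linarith)
  have h2 := sum_decr_lt_add_sum_decr_ge x l
  simp only [sub_mul, one_mul, Finset.sum_sub_distrib] at h
  linarith

/-! ### Supermajorization and averages of permutations -/

/-- Abel summation: monotone nonnegative weights preserve the nonnegativity of all tail sums. -/
lemma sum_mul_nonneg_of_tail_sums_nonneg : ∀ {n : ℕ} (c d : Fin n → ℝ), Monotone c →
    (∀ i, 0 ≤ c i) → (∀ l : ℕ, 0 ≤ ∑ i : Fin n with l ≤ i.val, d i) → 0 ≤ ∑ i, c i * d i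
  | 0, _, _, _, _, _ => by simp
  | n + 1, c, d, hc, hc0, hd => by
    have h0 : 0 ≤ ∑ i, d i := by simpa using hd 0
    have ih := sum_mul_nonneg_of_tail_sums_nonneg (fun i : Fin n => c i.succ - c 0)
      (fun i => d i.succ) (fun i j h => sub_le_sub_right (hc (Fin.succ_le_succ_iff.mpr h)) _)
      (fun i => sub_nonneg.mpr (hc (Fin.zero_le _)))
      (fun l => by
        have := hd (l + 1)
        rw [Finset.sum_filter, Fin.sum_univ_succ] at this
        rw [Finset.sum_filter]
        simpa using this)
    rw [Fin.sum_univ_succ] at h0 ⊢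
    have h1 : ∑ i : Fin n, c i.succ * d i.succ
        = ∑ i : Fin n, (c i.succ - c 0) * d i.succ + c 0 * ∑ i : Fin n, d i.succ := by
      rw [Finset.mul_sum, ← Finset.sum_add_distrib]
      exact Finset.sum_congr rfl fun i _ => by ring
    have := mul_nonneg (hc0 0) h0
    rw [h1]
    linarith

/-- If `x ≺^w z`, then no nonnegative linear functional separates `x` from the permutations
of `z`: the minimal value on the permutations of `z` pairs the largest entries of `z` with the
smallest coefficients. -/
lemma VecSupermajorized.exists_perm_sum_le {n : ℕ} {x z : Fin n → ℝ} (h : VecSupermajorized x z)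
    (c : Fin n → ℝ) (hc : ∀ i, 0 ≤ c i) :
    ∃ σ : Equiv.Perm (Fin n), ∑ i, c i * z (σ i) ≤ ∑ i, c i * x i := by
  let τ := Tuple.sort c
  have hτ : Monotone (c ∘ τ) := Tuple.monotone_sort c
  refine ⟨τ.symm.trans (decrPerm z), ?_⟩
  have h1 := sum_mul_nonneg_of_tail_sums_nonneg (c ∘ τ) (fun i => decr x i - decr z i) hτ
    (fun i => hc _) (fun l => by
      rw [Finset.sum_sub_distrib]; exact sub_nonneg.mpr (h l))
  simp only [mul_sub, Finset.sum_sub_distrib] at h1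
  have h2 : ∑ i, (c ∘ τ) i * decr x i ≤ ∑ i, c i * x i := by
    have := (hτ.antivary (decr_antitone x)).sum_mul_le_sum_mul_comp_perm
      (σ := τ.trans (decrPerm x).symm)
    refine this.trans_eq ?_
    rw [← Equiv.sum_comp τ (fun i => c i * x i)]
    simp [decr_eq]
  rw [← Equiv.sum_comp τ (fun i => c i * z _)]
  simp only [Equiv.trans_apply, Equiv.symm_apply_apply, ← decr_eq]
  simp only [Function.comp_apply] at h1 h2 ⊢
  linarith

open scoped Pointwise in
/-- If `x ≺^w z`, then `x` dominates entrywise some average of the permutations of `z`. -/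
lemma VecSupermajorized.exists_average_perm_le {n : ℕ} {x z : Fin n → ℝ}
    (h : VecSupermajorized x z) :
    ∃ q : Equiv.Perm (Fin n) → ℝ, (∀ σ, 0 ≤ q σ) ∧ ∑ σ, q σ = 1 ∧
      ∀ i, ∑ σ, q σ * z (σ i) ≤ x i := by
  let T : (Equiv.Perm (Fin n) → ℝ) →ₗ[ℝ] (Fin n → ℝ) :=
    { toFun := fun q i => ∑ σ, q σ * z (σ i)
      map_add' := fun a b => by ext i; simp [add_mul, Finset.sum_add_distrib]
      map_smul' := fun r a => by ext i; simp [mul_assoc, Finset.mul_sum] }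
  let S : Set (Fin n → ℝ) := Set.Ici (0 : Fin n → ℝ) + T '' stdSimplex ℝ (Equiv.Perm (Fin n))
  have hconv : Convex ℝ S := (convex_Ici (0 : Fin n → ℝ)).add
    ((convex_stdSimplex ℝ _).linear_image T)
  have hclosed : IsClosed S := isClosed_Ici.add_right_of_isCompact
    ((isCompact_stdSimplex ℝ _).image T.continuous_of_finiteDimensional)
  by_cases hxS : x ∈ S
  · obtain ⟨y, hy, _, ⟨q, hq, rfl⟩, rfl⟩ := hxS
    exact ⟨q, hq.1, hq.2, fun i => le_add_of_nonneg_left (hy i)⟩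
  · exfalso
    obtain ⟨f, u, hfx, hfS⟩ := geometric_hahn_banach_point_closed hconv hclosed hxS
    have hf : ∀ v, f v = ∑ i, f (Pi.single i 1) * v i := fun v => by
      have := LinearMap.pi_apply_eq_sum_univ f.toLinearMap v
      simp only [ContinuousLinearMap.coe_coe, smul_eq_mul] at this
      rw [this]
      refine Finset.sum_congr rfl fun i _ => ?_
      rw [mul_comm]
      congr 2
      ext j
      simp [Pi.single_apply, eq_comm]
    have hperm : ∀ σ : Equiv.Perm (Fin n), ∀ y, 0 ≤ y → y + (fun i => z (σ i)) ∈ S := by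
      intro σ y hy
      refine Set.add_mem_add hy ⟨Pi.single σ 1, single_mem_stdSimplex ℝ σ, ?_⟩
      ext i
      simp [T, Pi.single_apply]
    -- `S` is unbounded in the positive directions, so `f` is nonnegative there
    have hc : ∀ i, 0 ≤ f (Pi.single i 1) := by
      intro i
      by_contra! hneg
      set b := f (fun i => z i)
      have hb : u < b := by simpa using hfS _ (hperm 1 0 le_rfl)
      have := hfS _ (hperm 1 (((b - u) / -f (Pi.single i 1)) • Pi.single i 1)
        (smul_nonneg (div_nonneg (by linarith) (by linarith)) (Pi.single_nonneg.mpr zero_le_one)))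
      rw [map_add, map_smul, smul_eq_mul, div_neg, neg_mul, div_mul_cancel₀ _ hneg.ne] at this
      simp only [Equiv.Perm.coe_one, id] at this
      linarith
    obtain ⟨σ, hσ⟩ := h.exists_perm_sum_le _ hc
    have := hfS _ (hperm σ 0 le_rfl)
    rw [zero_add, hf] at this
    rw [hf] at hfx
    linarith

/-! ### Bipartite vectors as matrices -/

lemma ket_injective {n m : ℕ} :
    Function.Injective (ket : Matrix (Fin n) (Fin m) ℂ → Fin n × Fin m → ℂ) :=
  fun _ _ h => Matrix.ext fun i j => congrFun h (i, j)

lemma ket_sub {n m : ℕ} (X Y : Matrix (Fin n) (Fin m) ℂ) : ket (X - Y) = ket X - ket Y := rfl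

lemma ket_smul {n m : ℕ} (c : ℂ) (X : Matrix (Fin n) (Fin m) ℂ) : ket (c • X) = c • ket X := rfl

lemma kronecker_mulVec_ket {a b n m : ℕ} (K : Matrix (Fin n) (Fin a) ℂ)
    (L : Matrix (Fin m) (Fin b) ℂ) (X : Matrix (Fin a) (Fin b) ℂ) :
    (K ⊗ₖ L) *ᵥ ket X = ket (K * X * Lᵀ) := by
  ext ⟨i, j⟩
  simp only [Matrix.mulVec, dotProduct, Fintype.sum_prod_type, ket, Matrix.kroneckerMap_apply,
    Matrix.mul_apply, Matrix.transpose_apply, Finset.sum_mul]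
  rw [Finset.sum_comm]
  exact Finset.sum_congr rfl fun _ _ => Finset.sum_congr rfl fun _ _ => by ring

lemma alice_mulVec_ket {a b n : ℕ} (K : Matrix (Fin n) (Fin a) ℂ)
    (X : Matrix (Fin a) (Fin b) ℂ) :
    (K ⊗ₖ (1 : Matrix (Fin b) (Fin b) ℂ)) *ᵥ ket X = ket (K * X) := by
  rw [kronecker_mulVec_ket, Matrix.transpose_one, Matrix.mul_one]

lemma bob_mulVec_ket {a b m : ℕ} (K : Matrix (Fin m) (Fin b) ℂ)
    (X : Matrix (Fin a) (Fin b) ℂ) :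
    ((1 : Matrix (Fin a) (Fin a) ℂ) ⊗ₖ K) *ᵥ ket X = ket (X * Kᵀ) := by
  rw [kronecker_mulVec_ket, Matrix.one_mul]

lemma normSq_nonneg {n m : ℕ} (ψ : Fin n × Fin m → ℂ) : 0 ≤ normSq ψ :=
  Finset.sum_nonneg fun _ _ => sq_nonneg _

lemma normSq_smul {n m : ℕ} (c : ℂ) (ψ : Fin n × Fin m → ℂ) :
    normSq (c • ψ) = ‖c‖ ^ 2 * normSq ψ := by
  simp [normSq, mul_pow, Finset.mul_sum]

lemma normSq_ket {n m : ℕ} (X : Matrix (Fin n) (Fin m) ℂ) :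
    normSq (ket X) = ∑ i, ∑ j, ‖X i j‖ ^ 2 :=
  Fintype.sum_prod_type _

lemma mul_conjTranspose_diag {n m : ℕ} (X : Matrix (Fin n) (Fin m) ℂ) (i : Fin n) :
    (X * Xᴴ) i i = ((∑ j, ‖X i j‖ ^ 2 : ℝ) : ℂ) := by
  simp [Matrix.mul_apply, Complex.mul_conj']

lemma normSq_ket_eq_trace {n m : ℕ} (X : Matrix (Fin n) (Fin m) ℂ) :
    (normSq (ket X) : ℂ) = (X * Xᴴ).trace := by
  rw [normSq_ket, Matrix.trace, Complex.ofReal_sum]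
  exact Finset.sum_congr rfl fun i _ => (mul_conjTranspose_diag X i).symm

lemma normSq_ket_transpose {n m : ℕ} (X : Matrix (Fin n) (Fin m) ℂ) :
    normSq (ket Xᵀ) = normSq (ket X) := by
  rw [normSq_ket, normSq_ket, Finset.sum_comm]; rfl

/-- A complete local measurement of Alice preserves the total squared norm. -/
lemma sum_normSq_ket_mul {ι : Type*} [Fintype ι] {a b : ℕ} {d : ι → ℕ}
    (K : (i : ι) → Matrix (Fin (d i)) (Fin a) ℂ) (hK : ∑ i, (K i)ᴴ * K i = 1)
    (X : Matrix (Fin a) (Fin b) ℂ) : ∑ i, normSq (ket (K i * X)) = normSq (ket X) := by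
  apply Complex.ofReal_injective
  rw [Complex.ofReal_sum]
  have : ∀ i, (normSq (ket (K i * X)) : ℂ) = ((K i)ᴴ * K i * (X * Xᴴ)).trace := fun i => by
    rw [normSq_ket_eq_trace, Matrix.conjTranspose_mul, Matrix.mul_assoc (K i)ᴴ,
      Matrix.trace_mul_comm (K i)ᴴ]
    simp only [Matrix.mul_assoc]
  simp_rw [this]
  rw [← Matrix.trace_sum, ← Finset.sum_mul, hK, Matrix.one_mul, normSq_ket_eq_trace]

lemma normSq_ket_mul {a b r : ℕ} {K : Matrix (Fin r) (Fin a) ℂ} (hK : Kᴴ * K = 1)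
    (X : Matrix (Fin a) (Fin b) ℂ) : normSq (ket (K * X)) = normSq (ket X) := by
  simpa using sum_normSq_ket_mul (fun _ : Unit => K) (by simpa using hK) X

/-- A complete local measurement of Bob preserves the total squared norm. -/
lemma sum_normSq_ket_mul_transpose {ι : Type*} [Fintype ι] {a b : ℕ} {d : ι → ℕ}
    (K : (i : ι) → Matrix (Fin (d i)) (Fin b) ℂ) (hK : ∑ i, (K i)ᴴ * K i = 1)
    (X : Matrix (Fin a) (Fin b) ℂ) : ∑ i, normSq (ket (X * (K i)ᵀ)) = normSq (ket X) := by
  rw [← normSq_ket_transpose X, ← sum_normSq_ket_mul K hK Xᵀ]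
  refine Finset.sum_congr rfl fun i _ => ?_
  rw [← normSq_ket_transpose, Matrix.transpose_mul, Matrix.transpose_transpose]

/-! ### Spectral decomposition and distance to matrices of bounded rank -/

/-- The spectral theorem in product form. -/
lemma _root_.Matrix.IsHermitian.exists_unitary_eq {n : ℕ} {X : Matrix (Fin n) (Fin n) ℂ}
    (hX : X.IsHermitian) : ∃ U : Matrix (Fin n) (Fin n) ℂ, Uᴴ * U = 1 ∧ U * Uᴴ = 1 ∧
      X = U * Matrix.diagonal (fun i => (hX.eigenvalues i : ℂ)) * Uᴴ := by
  have hU := hX.eigenvectorUnitary.2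
  refine ⟨hX.eigenvectorUnitary, Matrix.mem_unitaryGroup_iff'.mp hU,
    Matrix.mem_unitaryGroup_iff.mp hU, ?_⟩
  conv_lhs => rw [hX.spectral_theorem, Unitary.conjStarAlgAut_apply]
  rfl

lemma conjTranspose_mul_mul_of_eq {n : ℕ} {U D X : Matrix (Fin n) (Fin n) ℂ} (h1 : Uᴴ * U = 1)
    (hX : X = U * D * Uᴴ) : Uᴴ * X * U = D := by
  rw [hX]
  calc Uᴴ * (U * D * Uᴴ) * U = (Uᴴ * U) * D * (Uᴴ * U) := by simp only [Matrix.mul_assoc]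
    _ = D := by rw [h1, Matrix.one_mul, Matrix.mul_one]

/-- The squared norms of the rows of `C * X` are weighted sums of the eigenvalues of `X * Xᴴ`. -/
lemma sum_norm_sq_mul_row {n m r : ℕ} {X : Matrix (Fin n) (Fin m) ℂ}
    {U : Matrix (Fin n) (Fin n) ℂ} {x : Fin n → ℝ}
    (hX : X * Xᴴ = U * Matrix.diagonal (fun i => (x i : ℂ)) * Uᴴ)
    (C : Matrix (Fin r) (Fin n) ℂ) (k : Fin r) :
    ∑ j, ‖(C * X) k j‖ ^ 2 = ∑ i, ‖(C * U) k i‖ ^ 2 * x i := by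
  apply Complex.ofReal_injective
  rw [← mul_conjTranspose_diag]
  have : C * X * (C * X)ᴴ = (C * U) * Matrix.diagonal (fun i => (x i : ℂ)) * (C * U)ᴴ := by
    rw [Matrix.conjTranspose_mul, Matrix.mul_assoc, ← Matrix.mul_assoc X, hX,
      Matrix.conjTranspose_mul]
    simp only [Matrix.mul_assoc]
  rw [this, Matrix.mul_apply]
  push_cast
  refine Finset.sum_congr rfl fun i _ => ?_
  rw [Matrix.mul_diagonal, Matrix.conjTranspose_apply, Complex.star_def, mul_right_comm,
    Complex.mul_conj']

lemma sum_norm_sq_row_of_mul_conjTranspose_eq_one {n m : ℕ} {W : Matrix (Fin n) (Fin m) ℂ}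
    (hW : W * Wᴴ = 1) (i : Fin n) : ∑ j, ‖W i j‖ ^ 2 = 1 := by
  apply Complex.ofReal_injective
  rw [← mul_conjTranspose_diag, hW, Matrix.one_apply_eq, Complex.ofReal_one]

lemma sum_norm_sq_col_of_conjTranspose_mul_eq_one {n m : ℕ} {W : Matrix (Fin n) (Fin m) ℂ}
    (hW : Wᴴ * W = 1) (j : Fin m) : ∑ i, ‖W i j‖ ^ 2 = 1 := by
  have h : Wᴴ * Wᴴᴴ = 1 := by rwa [Matrix.conjTranspose_conjTranspose]
  simpa using sum_norm_sq_row_of_mul_conjTranspose_eq_one h j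

open scoped ComplexOrder in
lemma eigenvalues_mul_conjTranspose_nonneg {n m : ℕ} {X : Matrix (Fin n) (Fin n) ℂ}
    {Y : Matrix (Fin n) (Fin m) ℂ} (hX : X.IsHermitian) (h : X = Y * Yᴴ) (i : Fin n) :
    0 ≤ hX.eigenvalues i := by
  subst h
  exact (Matrix.posSemidef_self_mul_conjTranspose Y).eigenvalues_nonneg i

open scoped ComplexOrder in
/-- Half of the Eckart–Young theorem: a matrix of rank at most `l` has squared distance from `Y` at
least the sum of the eigenvalues of `Y * Yᴴ` except the `l` largest ones. -/
lemma sum_decr_eigenvalues_le_normSq_sub {n m : ℕ} {X : Matrix (Fin n) (Fin n) ℂ}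
    (hX : X.IsHermitian) {Y : Matrix (Fin n) (Fin m) ℂ} (h : X = Y * Yᴴ) (l : ℕ)
    (Z : Matrix (Fin n) (Fin m) ℂ) (hZ : Z.rank ≤ l) :
    ∑ i : Fin n with l ≤ i.val, decr hX.eigenvalues i ≤ normSq (ket (Y - Z)) := by
  obtain ⟨V, hV1, hV2, hV⟩ := hX.exists_unitary_eq
  replace hV := h.symm.trans hV
  have hZH := Matrix.isHermitian_mul_conjTranspose_self Z
  obtain ⟨U, hU1, hU2, hU⟩ := hZH.exists_unitary_eq
  -- the eigenvectors of `Z * Zᴴ` with eigenvalue `0` are orthogonal to the columns of `Z`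
  let N : Finset (Fin n) := {k | hZH.eigenvalues k = 0}
  have hcard : (n : ℝ) ≤ N.card + l := by
    have h1 := hZH.rank_eq_card_non_zero_eigs
    rw [Matrix.rank_self_mul_conjTranspose, Fintype.card_subtype] at h1
    have h2 := Finset.card_filter_add_card_filter_not (s := Finset.univ)
      (fun k => hZH.eigenvalues k = 0)
    rw [Finset.card_univ, Fintype.card_fin] at h2
    have : n ≤ N.card + l := by
      simp only [N]; simp only [ne_eq] at h1; omega
    exact_mod_cast this
  have hzero : ∀ k ∈ N, ∀ j, (Uᴴ * Z) k j = 0 := by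
    intro k hk
    have h1 := sum_norm_sq_mul_row hU Uᴴ k
    rw [hU1] at h1
    have h2 : ∑ j, ‖(Uᴴ * Z) k j‖ ^ 2 = 0 := by
      rw [h1]
      refine Finset.sum_eq_zero fun i _ => ?_
      by_cases hi : k = i
      · subst hi; rw [(Finset.mem_filter.mp hk).2, mul_zero]
      · simp [hi]
    intro j
    have := (Finset.sum_eq_zero_iff_of_nonneg (fun _ _ => sq_nonneg _)).mp h2 j (Finset.mem_univ _)
    simpa using this
  set W := Uᴴ * V with hW
  have hW1 : Wᴴ * W = 1 := by
    rw [hW, Matrix.conjTranspose_mul, Matrix.conjTranspose_conjTranspose, Matrix.mul_assoc,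
      ← Matrix.mul_assoc U, hU2, Matrix.one_mul, hV1]
  have hW2 : W * Wᴴ = 1 := by
    rw [hW, Matrix.conjTranspose_mul, Matrix.conjTranspose_conjTranspose, Matrix.mul_assoc,
      ← Matrix.mul_assoc V, hV2, Matrix.one_mul, hU1]
  calc ∑ i : Fin n with l ≤ i.val, decr hX.eigenvalues i
      ≤ ∑ i, (∑ k ∈ N, ‖W k i‖ ^ 2) * hX.eigenvalues i := by
        refine sum_decr_le_sum_mul _ _ _ (eigenvalues_mul_conjTranspose_nonneg hX h)
          (fun i => Finset.sum_nonneg fun _ _ => sq_nonneg _) (fun i => ?_) ?_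
        · rw [← sum_norm_sq_col_of_conjTranspose_mul_eq_one hW1 i]
          exact Finset.sum_le_sum_of_subset_of_nonneg (Finset.subset_univ _)
            fun _ _ _ => sq_nonneg _
        · rw [Finset.sum_comm, Finset.sum_congr rfl
            (fun k _ => sum_norm_sq_row_of_mul_conjTranspose_eq_one hW2 k)]
          simpa using hcard
    _ = ∑ k ∈ N, ∑ j, ‖(Uᴴ * Y) k j‖ ^ 2 := by
        simp_rw [sum_norm_sq_mul_row hV, Finset.sum_mul]
        exact Finset.sum_comm
    _ = ∑ k ∈ N, ∑ j, ‖(Uᴴ * (Y - Z)) k j‖ ^ 2 := by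
        refine Finset.sum_congr rfl fun k hk => Finset.sum_congr rfl fun j _ => ?_
        rw [Matrix.mul_sub, Matrix.sub_apply, hzero k hk, sub_zero]
    _ ≤ ∑ k, ∑ j, ‖(Uᴴ * (Y - Z)) k j‖ ^ 2 :=
        Finset.sum_le_sum_of_subset_of_nonneg (Finset.subset_univ _)
          fun _ _ _ => Finset.sum_nonneg fun _ _ => sq_nonneg _
    _ = normSq (ket (Y - Z)) := by
        rw [← normSq_ket, normSq_ket_mul (by rwa [Matrix.conjTranspose_conjTranspose])]

/-- The other half of the Eckart–Young theorem: the bound is attained by cutting `Y` down to the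
span of the eigenvectors of the `l` largest eigenvalues of `Y * Yᴴ`. -/
lemma exists_rank_le_normSq_sub_eq {n m : ℕ} {X : Matrix (Fin n) (Fin n) ℂ}
    (hX : X.IsHermitian) {Y : Matrix (Fin n) (Fin m) ℂ} (h : X = Y * Yᴴ) (l : ℕ) :
    ∃ Z : Matrix (Fin n) (Fin m) ℂ, Z.rank ≤ l ∧
      normSq (ket (Y - Z)) = ∑ i : Fin n with l ≤ i.val, decr hX.eigenvalues i := by
  obtain ⟨V, hV1, hV2, hV⟩ := hX.exists_unitary_eq
  replace hV := h.symm.trans hV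
  let t : Fin n → ℂ := fun i => if ((decrPerm hX.eigenvalues).symm i).val < l then 1 else 0
  refine ⟨V * Matrix.diagonal t * (Vᴴ * Y), ?_, ?_⟩
  · refine (Matrix.rank_mul_le_left _ _).trans ((Matrix.rank_mul_le_right _ _).trans ?_)
    rw [Matrix.rank_diagonal, Fintype.card_subtype]
    have h1 : Finset.card {i : Fin n | t i ≠ 0} = Finset.card {i : Fin n | i.val < l} := by
      refine Finset.card_equiv (decrPerm hX.eigenvalues).symm fun i => ?_
      simp [t]
    rw [h1, Fin.card_filter_val_lt]
    exact min_le_right _ _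
  · have h1 : Y - V * Matrix.diagonal t * (Vᴴ * Y)
        = V * (Matrix.diagonal (fun i => 1 - t i) * Vᴴ * Y) := by
      rw [← Matrix.diagonal_sub, Matrix.diagonal_one, Matrix.sub_mul, Matrix.sub_mul,
        Matrix.mul_sub, Matrix.one_mul, ← Matrix.mul_assoc V Vᴴ, hV2, Matrix.one_mul]
      simp only [Matrix.mul_assoc]
    rw [h1, normSq_ket_mul hV1, normSq_ket]
    simp_rw [sum_norm_sq_mul_row hV, Matrix.mul_assoc _ Vᴴ V, hV1, Matrix.mul_one]
    rw [← Equiv.sum_comp (decrPerm hX.eigenvalues), Finset.sum_filter]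
    refine Finset.sum_congr rfl fun k _ => ?_
    rw [Finset.sum_eq_single (decrPerm hX.eigenvalues k)
      (fun i _ hi => by simp [Matrix.diagonal_apply_ne _ hi.symm]) (by simp)]
    by_cases hk : k.val < l
    · simp [t, hk]
    · simp [t, hk, decr_eq, not_lt.mp hk]

/-! ### Monotones of LOCC protocols -/

lemma rank_smul_le {n m : ℕ} (c : ℂ) (X : Matrix (Fin n) (Fin m) ℂ) : (c • X).rank ≤ X.rank := by
  rw [← Matrix.one_mul X, ← Matrix.smul_mul]
  exact (Matrix.rank_mul_le_right _ _).trans_eq (by rw [Matrix.one_mul])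

/-- The squared distance to the matrices of rank at most `l` does not increase on average, because
local operations do not increase the rank of the approximating matrix. -/
lemma Protocol.successProb_mul_le_normSq_sub {N M : ℕ} {φ : Fin N × Fin M → ℂ} (hφ : IsState φ)
    {l : ℕ} {e : ℝ}
    (he : ∀ Z : Matrix (Fin N) (Fin M) ℂ, Z.rank ≤ l → e ≤ normSq (φ - ket Z)) {a b : ℕ}
    (P : Protocol N M a b) : ∀ (X : Matrix (Fin a) (Fin b) ℂ), P.Produces φ (ket X) →
      ∀ Z : Matrix (Fin a) (Fin b) ℂ, Z.rank ≤ l →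
        P.successProb (ket X) * e ≤ normSq (ket (X - Z)) := by
  induction P with
  | abort =>
    intro X _ Z _
    simpa [Protocol.successProb] using normSq_nonneg _
  | accept =>
    rintro X ⟨c, hc⟩ Z hZ
    simp only [Protocol.successProb]
    rw [ket_sub, hc, normSq_smul, hφ, mul_one]
    by_cases hc0 : c = 0
    · simpa [hc0] using normSq_nonneg _
    · have h1 : c • φ - ket Z = c • (φ - ket (c⁻¹ • Z)) := by
        rw [ket_smul, smul_sub, smul_inv_smul₀ hc0]
      rw [h1, normSq_smul]
      refine mul_le_mul_of_nonneg_left (he _ ?_) (sq_nonneg _)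
      exact (rank_smul_le _ _).trans hZ
  | alice d K hK next ih =>
    intro X hX Z hZ
    simp only [Protocol.Produces, Protocol.successProb, alice_mulVec_ket] at hX ⊢
    rw [Finset.sum_mul, ← sum_normSq_ket_mul K hK]
    refine Finset.sum_le_sum fun i _ => ?_
    rw [Matrix.mul_sub]
    exact ih i _ (hX i) _ ((Matrix.rank_mul_le_right _ _).trans hZ)
  | bob d K hK next ih =>
    intro X hX Z hZ
    simp only [Protocol.Produces, Protocol.successProb, bob_mulVec_ket] at hX ⊢
    rw [Finset.sum_mul, ← sum_normSq_ket_mul_transpose K hK]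
    refine Finset.sum_le_sum fun i _ => ?_
    rw [Matrix.sub_mul]
    exact ih i _ (hX i) _ ((Matrix.rank_mul_le_left _ _).trans hZ)

/-- A protocol that succeeds with nonzero probability does not increase the Schmidt rank. -/
lemma Protocol.rank_le_of_successProb_ne_zero {N M : ℕ} {B : Matrix (Fin N) (Fin M) ℂ} {a b : ℕ}
    (P : Protocol N M a b) : ∀ (X : Matrix (Fin a) (Fin b) ℂ), P.Produces (ket B) (ket X) →
      P.successProb (ket X) ≠ 0 → B.rank ≤ X.rank := by
  induction P with
  | abort => exact fun X _ h => absurd rfl h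
  | accept =>
    rintro X ⟨c, hc⟩ h
    have hc0 : c ≠ 0 := by
      rintro rfl
      exact h (by simp [Protocol.successProb, hc, normSq])
    rw [ket_injective (hc.trans (ket_smul c B).symm)]
    conv_lhs => rw [← inv_smul_smul₀ hc0 B]
    exact rank_smul_le _ _
  | alice d K hK next ih =>
    intro X hX h
    simp only [Protocol.Produces, Protocol.successProb, alice_mulVec_ket] at hX h
    obtain ⟨i, _, hi⟩ := Finset.exists_ne_zero_of_sum_ne_zero h
    exact (ih i _ (hX i) hi).trans (Matrix.rank_mul_le_right _ _)
  | bob d K hK next ih =>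
    intro X hX h
    simp only [Protocol.Produces, Protocol.successProb, bob_mulVec_ket] at hX h
    obtain ⟨i, _, hi⟩ := Finset.exists_ne_zero_of_sum_ne_zero h
    exact (ih i _ (hX i) hi).trans (Matrix.rank_mul_le_left _ _)

lemma isHermitian_smul_mul_conjTranspose {n m : ℕ} (B : Matrix (Fin n) (Fin m) ℂ) (p : ℝ) :
    (p • (B * Bᴴ)).IsHermitian := by
  rw [Matrix.IsHermitian, Matrix.conjTranspose_smul, Matrix.conjTranspose_mul,
    Matrix.conjTranspose_conjTranspose, star_trivial]

lemma smul_mul_conjTranspose_eq {n m : ℕ} (B : Matrix (Fin n) (Fin m) ℂ) {p : ℝ} (hp : 0 ≤ p) :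
    p • (B * Bᴴ) = (((√p : ℝ) : ℂ) • B) * (((√p : ℝ) : ℂ) • B)ᴴ := by
  rw [Matrix.conjTranspose_smul, Matrix.smul_mul, Matrix.mul_smul, smul_smul, Complex.star_def,
    Complex.conj_ofReal, ← Complex.ofReal_mul, Real.mul_self_sqrt hp]
  rfl

lemma LOCCTransforms.supermajorized {n m : ℕ} {A B : Matrix (Fin n) (Fin m) ℂ}
    (hB : IsState (ket B)) {p : ℝ} (hp : 0 ≤ p) (h : LOCCTransforms A B p) :
    Supermajorized (A * Aᴴ) (p • (B * Bᴴ)) := by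
  obtain ⟨P, hP, rfl⟩ := h
  set p := P.successProb (ket A) with hpdef
  refine ⟨Matrix.isHermitian_mul_conjTranspose_self A, isHermitian_smul_mul_conjTranspose B p,
    fun l => ?_⟩
  obtain ⟨Z, hZ, hZA⟩ := exists_rank_le_normSq_sub_eq
    (Matrix.isHermitian_mul_conjTranspose_self A) rfl l
  have hlow := sum_decr_eigenvalues_le_normSq_sub (isHermitian_smul_mul_conjTranspose B p)
    (smul_mul_conjTranspose_eq B hp) l
  set E := ∑ i : Fin n with l ≤ i.val,
    decr (isHermitian_smul_mul_conjTranspose B p).eigenvalues i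
  rw [← hZA]
  rcases hp.eq_or_lt with hp0 | hp0
  · refine (hlow 0 (by simp)).trans ?_
    rw [← hp0]
    simpa [normSq, ket] using normSq_nonneg _
  · have h1 := P.successProb_mul_le_normSq_sub hB (l := l) (e := E / p) (fun W hW => by
      rw [div_le_iff₀ hp0]
      refine (hlow (((√p : ℝ) : ℂ) • W) ((rank_smul_le _ _).trans hW)).trans_eq ?_
      rw [← smul_sub, ket_smul, normSq_smul, ket_sub, Complex.norm_real, Real.norm_eq_abs, sq_abs,
        Real.sq_sqrt hp, mul_comm]) A hP Z hZ
    rwa [← hpdef, mul_div_cancel₀ _ hp0.ne'] at h1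

lemma LOCCTransforms.rank_le {n m : ℕ} {A B : Matrix (Fin n) (Fin m) ℂ} {p : ℝ} (hp : 0 < p)
    (h : LOCCTransforms A B p) : B.rank ≤ A.rank := by
  obtain ⟨P, hP, rfl⟩ := h
  exact P.rank_le_of_successProb_ne_zero A hP hp.ne'

/-! ### Pure transformations -/

/-- A complete measurement preserves the total squared norm of each column. -/
lemma sum_sum_norm_sq_mul_col {ι : Type*} [Fintype ι] {a b n : ℕ}
    {K : ι → Matrix (Fin n) (Fin a) ℂ} (hK : ∑ i, (K i)ᴴ * K i = 1)
    (X : Matrix (Fin a) (Fin b) ℂ) (j : Fin b) :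
    ∑ i, ∑ r, ‖(K i * X) r j‖ ^ 2 = ∑ r, ‖X r j‖ ^ 2 := by
  have hcol : ∀ {c : ℕ} (Y : Matrix (Fin c) (Fin b) ℂ),
      ((∑ r, ‖Y r j‖ ^ 2 : ℝ) : ℂ) = (Yᴴ * Y) j j := fun Y => by
    have := mul_conjTranspose_diag Yᴴ j
    rw [Matrix.conjTranspose_conjTranspose] at this
    simpa using this.symm
  apply Complex.ofReal_injective
  have h : ∑ i, (K i * X)ᴴ * (K i * X) = Xᴴ * X := by
    have : ∀ i, (K i * X)ᴴ * (K i * X) = Xᴴ * ((K i)ᴴ * K i) * X := fun i => by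
      simp only [Matrix.conjTranspose_mul, Matrix.mul_assoc]
    simp_rw [this]
    rw [← Matrix.sum_mul, ← Matrix.mul_sum, hK, Matrix.mul_one]
  rw [Complex.ofReal_sum, hcol, ← h, Matrix.sum_apply]
  exact Finset.sum_congr rfl fun i _ => hcol _

/-- A measurement operator does not increase the sums of the largest eigenvalues of `Y * Yᴴ`. -/
lemma vecSubmajorized_of_measurement {ι : Type*} [Fintype ι] {n m : ℕ}
    {Y : Matrix (Fin n) (Fin m) ℂ} {K : ι → Matrix (Fin n) (Fin n) ℂ}
    (hK : ∑ i, (K i)ᴴ * K i = 1) (a : ι)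
    {S T : Matrix (Fin n) (Fin n) ℂ} (hS : S.IsHermitian) (hT : T.IsHermitian)
    (hSK : S = (K a * Y) * (K a * Y)ᴴ) (hTY : T = Y * Yᴴ) :
    VecSubmajorized hS.eigenvalues hT.eigenvalues := by
  intro l
  obtain ⟨V, hV1, hV2, hV⟩ := hS.exists_unitary_eq
  obtain ⟨U, hU1, hU2, hU⟩ := hT.exists_unitary_eq
  let W : ι → Matrix (Fin n) (Fin n) ℂ := fun i => Vᴴ * K i * U
  have hW : ∑ i, (W i)ᴴ * W i = 1 := by
    have : ∀ i, (W i)ᴴ * W i = Uᴴ * ((K i)ᴴ * K i) * U := fun i => by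
      simp only [W, Matrix.conjTranspose_mul, Matrix.conjTranspose_conjTranspose]
      calc Uᴴ * ((K i)ᴴ * V) * (Vᴴ * K i * U) = Uᴴ * ((K i)ᴴ * (V * Vᴴ) * K i) * U := by
            simp only [Matrix.mul_assoc]
        _ = _ := by rw [hV2, Matrix.mul_one]
    simp_rw [this]
    rw [← Finset.sum_mul, ← Finset.mul_sum, hK, Matrix.mul_one, hU1]
  have hcontr : ∀ X : Matrix (Fin n) (Fin n) ℂ, ∀ j,
      ∑ r, ‖(W a * X) r j‖ ^ 2 ≤ ∑ r, ‖X r j‖ ^ 2 := fun X j => by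
    rw [← sum_sum_norm_sq_mul_col hW X]
    exact Finset.single_le_sum (f := fun i => ∑ r, ‖(W i * X) r j‖ ^ 2)
      (fun i _ => Finset.sum_nonneg fun _ _ => sq_nonneg _) (Finset.mem_univ a)
  have hcol : ∀ i, ∑ j, ‖W a j i‖ ^ 2 ≤ 1 := fun i => by
    have := hcontr 1 i
    rw [Matrix.mul_one] at this
    exact this.trans_eq (sum_norm_sq_col_of_conjTranspose_mul_eq_one (by simp) i)
  -- the adjoint of a contraction is a contraction: apply `W a` to the columns of its adjoint
  have hrow : ∀ j, ∑ i, ‖W a j i‖ ^ 2 ≤ 1 := fun j => by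
    have h1 := hcontr (W a)ᴴ j
    simp only [Matrix.conjTranspose_apply, norm_star] at h1
    have h2 : ‖(W a * (W a)ᴴ) j j‖ ^ 2 ≤ ∑ r, ‖(W a * (W a)ᴴ) r j‖ ^ 2 :=
      Finset.single_le_sum (f := fun r => ‖(W a * (W a)ᴴ) r j‖ ^ 2)
        (fun _ _ => sq_nonneg _) (Finset.mem_univ j)
    rw [mul_conjTranspose_diag, Complex.norm_real, Real.norm_eq_abs, sq_abs] at h2
    by_contra! h3
    nlinarith
  have hs : ∀ j, hS.eigenvalues j = ∑ i, ‖W a j i‖ ^ 2 * hT.eigenvalues i := fun j => by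
    have h1 := sum_norm_sq_mul_row (hSK.symm.trans hV) Vᴴ j
    have h2 := sum_norm_sq_mul_row (hTY.symm.trans hU) (Vᴴ * K a) j
    rw [← Matrix.mul_assoc] at h1
    rw [← h2, h1, hV1, Finset.sum_eq_single j (fun i _ hi => by simp [Matrix.one_apply_ne' hi])
      (by simp)]
    simp
  have hsum : ∑ j : Fin n with j.val < l, decr hS.eigenvalues j
      = ∑ i, (∑ j : Fin n with j.val < l, ‖W a (decrPerm hS.eigenvalues j) i‖ ^ 2)
        * hT.eigenvalues i := by
    simp_rw [decr_eq, hs, Finset.sum_mul]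
    exact Finset.sum_comm
  rw [hsum]
  refine sum_mul_le_sum_decr _ _ _ (eigenvalues_mul_conjTranspose_nonneg hT hTY)
    (fun i => Finset.sum_nonneg fun _ _ => sq_nonneg _) (fun i => ?_) ?_
  · refine le_trans ?_ (hcol i)
    rw [← Equiv.sum_comp (decrPerm hS.eigenvalues)]
    exact Finset.sum_le_sum_of_subset_of_nonneg (Finset.subset_univ _) fun _ _ _ => sq_nonneg _
  · rw [Finset.sum_comm]
    refine (Finset.sum_le_sum fun j _ => hrow (decrPerm hS.eigenvalues j)).trans ?_
    rw [Finset.sum_const, nsmul_eq_mul, mul_one, Fin.card_filter_val_lt]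
    exact_mod_cast min_le_right _ _

lemma PureLOCCTransforms.submajorized {n m : ℕ} {A B : Matrix (Fin n) (Fin m) ℂ} {p : ℝ}
    (hp : 0 ≤ p) (h : PureLOCCTransforms A B p) : Submajorized (p • (B * Bᴴ)) (A * Aᴴ) := by
  obtain ⟨k, K, i, hK, U, hU, h⟩ := h
  refine ⟨isHermitian_smul_mul_conjTranspose B p, Matrix.isHermitian_mul_conjTranspose_self A,
    vecSubmajorized_of_measurement hK i _ _ ?_ rfl⟩
  rw [kronecker_mulVec_ket, ← ket_smul] at h
  have hU' : Uᵀ * Uᵀᴴ = 1 := by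
    have h1 : Uᴴ * U = 1 := Matrix.mem_unitaryGroup_iff'.mp hU
    rw [show Uᵀᴴ = Uᴴᵀ from rfl, ← Matrix.transpose_mul, h1, Matrix.transpose_one]
  rw [smul_mul_conjTranspose_eq B hp, ← ket_injective h, Matrix.conjTranspose_mul,
    Matrix.mul_assoc, ← Matrix.mul_assoc Uᵀ, hU', Matrix.one_mul]

/-! ### Local unitary equivalence -/

/-- Linear maps into a finite-dimensional inner product space with equal norms at every vector
differ by an isometry of the target. -/
lemma exists_linearIsometry_comp_eq {E V : Type*} [AddCommGroup E] [Module ℂ E]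
    [NormedAddCommGroup V] [InnerProductSpace ℂ V] [FiniteDimensional ℂ V] (f g : E →ₗ[ℂ] V)
    (h : ∀ v, ‖f v‖ = ‖g v‖) : ∃ L : V →ₗᵢ[ℂ] V, ∀ v, L (f v) = g v := by
  have hker : f.ker ≤ g.ker := fun v hv => by
    rw [LinearMap.mem_ker] at hv ⊢
    rw [← norm_eq_zero, ← h, hv, norm_zero]
  -- `f v ↦ g v` is well defined on the range of `f`, and isometric
  let L₀ : f.range →ₗ[ℂ] V := f.ker.liftQ g hker ∘ₗ f.quotKerEquivRange.symm.toLinearMap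
  have hL₀ : ∀ v, L₀ (f.rangeRestrict v) = g v := fun v => by
    have : f.quotKerEquivRange.symm (f.rangeRestrict v) = f.ker.mkQ v := by
      rw [LinearEquiv.symm_apply_eq]
      rfl
    simp [L₀, this]
  let L₁ : f.range →ₗᵢ[ℂ] V :=
    { toLinearMap := L₀
      norm_map' := by
        intro w
        obtain ⟨v, rfl⟩ := f.surjective_rangeRestrict w
        rw [hL₀, ← h]
        rfl }
  refine ⟨L₁.extend, fun v => ?_⟩
  rw [← hL₀ v]
  exact L₁.extend_apply (f.rangeRestrict v)

/-- Bob can turn `|X⟩⟩` into `|Y⟩⟩` by a unitary if Alice's reduced states agree. -/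
lemma exists_unitary_mul_transpose_eq {n m : ℕ} {X Y : Matrix (Fin n) (Fin m) ℂ}
    (h : X * Xᴴ = Y * Yᴴ) : ∃ U : Matrix (Fin m) (Fin m) ℂ, Uᴴ * U = 1 ∧ X * Uᵀ = Y := by
  have hnorm : ∀ (Z : Matrix (Fin n) (Fin m) ℂ) (v : EuclideanSpace ℂ (Fin n)),
      ((‖Zᴴ.toEuclideanLin v‖ ^ 2 : ℝ) : ℂ) = star v.ofLp ⬝ᵥ ((Z * Zᴴ) *ᵥ v.ofLp) := by
    intro Z v
    rw [EuclideanSpace.norm_sq_eq, ← Matrix.mulVec_mulVec, Matrix.dotProduct_mulVec,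
      ← Matrix.conjTranspose_conjTranspose Z, ← Matrix.star_mulVec,
      Matrix.conjTranspose_conjTranspose]
    simp [dotProduct, Matrix.toLpLin_apply, Complex.conj_mul']
  obtain ⟨L, hL⟩ := exists_linearIsometry_comp_eq Xᴴ.toEuclideanLin Yᴴ.toEuclideanLin (fun v => by
    rw [← sq_eq_sq₀ (norm_nonneg _) (norm_nonneg _)]
    apply Complex.ofReal_injective
    rw [hnorm, hnorm, h])
  let T : Matrix (Fin m) (Fin m) ℂ := Matrix.toEuclideanLin.symm L.toLinearMap
  have hT : T.toEuclideanLin = L.toLinearMap := LinearEquiv.apply_symm_apply _ _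
  have hTT : Tᴴ * T = 1 := by
    have h1 : ∀ v w : Fin m → ℂ, star (T *ᵥ v) ⬝ᵥ (T *ᵥ w) = star v ⬝ᵥ w := by
      intro v w
      have h2 := L.inner_map_map (WithLp.toLp 2 v) (WithLp.toLp 2 w)
      have h3 : ∀ u : Fin m → ℂ, L (WithLp.toLp 2 u) = WithLp.toLp 2 (T *ᵥ u) := fun u => by
        rw [← LinearIsometry.coe_toLinearMap, ← hT, Matrix.toLpLin_apply]
      rw [h3, h3, EuclideanSpace.inner_eq_star_dotProduct,
        EuclideanSpace.inner_eq_star_dotProduct] at h2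
      simpa [dotProduct_comm] using h2
    ext i j
    have h4 := h1 (Pi.single i 1) (Pi.single j 1)
    rw [Matrix.star_mulVec, Matrix.dotProduct_mulVec, Matrix.vecMul_vecMul,
      ← Matrix.dotProduct_mulVec] at h4
    simpa [Matrix.one_apply, Pi.single_apply, eq_comm] using h4
  have hTX : T * Xᴴ = Yᴴ := by
    apply Matrix.toEuclideanLin.injective
    ext1 v
    rw [← hL v, ← LinearIsometry.coe_toLinearMap, ← hT]
    simp [Matrix.toLpLin_apply]
  -- Bob's operators act on the matrix through their transposes
  refine ⟨Tᴴᵀ, ?_, ?_⟩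
  · rw [show Tᴴᵀᴴ = Tᵀ by ext; simp, ← Matrix.transpose_mul, hTT, Matrix.transpose_one]
  · rw [Matrix.transpose_transpose, ← Matrix.conjTranspose_conjTranspose X,
      ← Matrix.conjTranspose_mul, hTX, Matrix.conjTranspose_conjTranspose]

/-! ### Construction of protocols -/

lemma fixedLOCCTransforms_zero {n m : ℕ} (X B : Matrix (Fin n) (Fin m) ℂ) :
    FixedLOCCTransforms X B 0 :=
  ⟨.abort, trivial, trivial, rfl⟩

/-- Alice starts with a measurement, after which the protocols for the outcomes are followed. -/
lemma fixedLOCCTransforms_of_measurement {ι : Type*} [Fintype ι] {n m : ℕ}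
    {B X : Matrix (Fin n) (Fin m) ℂ}
    {K : ι → Matrix (Fin n) (Fin n) ℂ} (hK : ∑ i, (K i)ᴴ * K i = 1) {r : ι → ℝ}
    (h : ∀ i, FixedLOCCTransforms (K i * X) B (r i)) : FixedLOCCTransforms X B (∑ i, r i) := by
  choose P hP1 hP2 hP3 using h
  let e := (Fintype.equivFin ι).symm
  refine ⟨.alice (fun _ => n) (fun i => K (e i))
    ((Equiv.sum_comp e fun i => (K i)ᴴ * K i).trans hK) (fun i => P (e i)),
    fun i => ⟨rfl, hP1 _⟩, fun i => ?_, ?_⟩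
  · rw [alice_mulVec_ket]
    exact hP2 _
  · simp only [Protocol.successProb, alice_mulVec_ket, hP3]
    exact Equiv.sum_comp e r

/-- If Alice's reduced state is `r` times that of `B`, a unitary of Bob completes the
transformation, with probability `r`. -/
lemma fixedLOCCTransforms_of_mul_conjTranspose_eq {n m : ℕ} {B X : Matrix (Fin n) (Fin m) ℂ}
    (hB : IsState (ket B)) {r : ℝ} (hr : 0 ≤ r) (h : X * Xᴴ = r • (B * Bᴴ)) :
    FixedLOCCTransforms X B r := by
  obtain ⟨U, hU, hXU⟩ := exists_unitary_mul_transpose_eq (h.trans (smul_mul_conjTranspose_eq B hr))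
  let P : Protocol n m n m := .bob (k := 1) (fun _ => m) (fun _ => U) (by simpa using hU)
    (fun _ => .accept)
  have hP : P.Produces (ket B) (ket X) := fun i => ⟨((√r : ℝ) : ℂ), by
    rw [bob_mulVec_ket, hXU, ket_smul]⟩
  refine ⟨P, fun i => ⟨rfl, trivial⟩, hP, ?_⟩
  simp only [P, Protocol.successProb, bob_mulVec_ket, hXU, ket_smul, normSq_smul]
  rw [hB]
  simp [Real.sq_sqrt hr]

/-- The matrix `U` with permuted columns diagonalizes the same matrices, with permuted
eigenvalues. -/
lemma submatrix_mul_diagonal_mul_conjTranspose {n : ℕ} (U : Matrix (Fin n) (Fin n) ℂ)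
    (z : Fin n → ℂ) (σ : Equiv.Perm (Fin n)) :
    U.submatrix id σ * Matrix.diagonal (fun i => z (σ i)) * (U.submatrix id σ)ᴴ
      = U * Matrix.diagonal z * Uᴴ := by
  rw [show (Matrix.diagonal fun i => z (σ i)) = (Matrix.diagonal z).submatrix σ σ from
    (Matrix.submatrix_diagonal_equiv z σ).symm, Matrix.conjTranspose_submatrix,
    Matrix.submatrix_mul_equiv, Matrix.submatrix_mul_equiv, Matrix.submatrix_id_id]

lemma diagonal_ofReal_conjTranspose {n : ℕ} (s : Fin n → ℝ) :
    (Matrix.diagonal fun i => (s i : ℂ))ᴴ = Matrix.diagonal fun i => (s i : ℂ) := by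
  rw [Matrix.diagonal_conjTranspose]
  congr 1
  ext i
  simp

/-- Alice measures with one operator for each permutation of the eigenvectors, weighted by an
average of permutations that witnesses the supermajorization; Bob then applies a unitary. -/
lemma fixedLOCCTransforms_of_supermajorized {n m : ℕ} {A B : Matrix (Fin n) (Fin m) ℂ}
    (hB : IsState (ket B)) {p : ℝ} (hp : 0 ≤ p)
    (h : Supermajorized (A * Aᴴ) (p • (B * Bᴴ))) : FixedLOCCTransforms A B p := by
  obtain ⟨hX, hY, h⟩ := h
  obtain ⟨U, hU1, hU2, hU⟩ := hX.exists_unitary_eq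
  obtain ⟨V, hV1, hV2, hV⟩ := hY.exists_unitary_eq
  have hx := eigenvalues_mul_conjTranspose_nonneg hX rfl
  have hz := eigenvalues_mul_conjTranspose_nonneg hY (smul_mul_conjTranspose_eq B hp)
  set x := hX.eigenvalues
  set z := hY.eigenvalues
  obtain ⟨q, hq0, hq1, hq⟩ := h.exists_average_perm_le
  have hqz : ∀ σ i, 0 ≤ q σ * z (σ i) := fun σ i => mul_nonneg (hq0 σ) (hz _)
  -- the square of the factor by which outcome `σ` scales the `i`-th eigenvector; it is `0` if
  -- `x i = 0`
  let s : Equiv.Perm (Fin n) → Fin n → ℝ := fun σ i => q σ * z (σ i) / x i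
  have hs0 : ∀ σ i, 0 ≤ s σ i := fun σ i => div_nonneg (hqz σ i) (hx i)
  have hs1 : ∀ i, ∑ σ, s σ i ≤ 1 := fun i => by
    rw [← Finset.sum_div]
    exact div_le_one_of_le₀ (hq i) (hx i)
  have hsx : ∀ σ i, s σ i * x i = q σ * z (σ i) := fun σ i => by
    rcases (hx i).eq_or_lt with h0 | h0
    · have h1 : q σ * z (σ i) ≤ 0 := by
        rw [h0]
        exact (Finset.single_le_sum (f := fun σ => q σ * z (σ i)) (fun σ _ => hqz σ i)
          (Finset.mem_univ σ)).trans (hq i)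
      rw [← h0, mul_zero]
      exact (le_antisymm h1 (hqz σ i)).symm
    · exact div_mul_cancel₀ _ h0.ne'
  let D : (Fin n → ℝ) → Matrix (Fin n) (Fin n) ℂ :=
    fun t => Matrix.diagonal fun i => ((t i : ℝ) : ℂ)
  have hD : ∀ t t', D t * D t' = D (t * t') := fun t t' => by simp [D]
  have hDH : ∀ t, (D t)ᴴ = D t := diagonal_ofReal_conjTranspose
  have hDsq : ∀ t : Fin n → ℝ, (∀ i, 0 ≤ t i) → D (fun i => √(t i)) * D (fun i => √(t i)) = D t :=
    fun t ht => by
      rw [hD]; congr 1; ext i; exact Real.mul_self_sqrt (ht i)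
  -- the outcome `none` is the failure
  let t : Option (Equiv.Perm (Fin n)) → Fin n → ℝ :=
    fun o => o.elim (fun i => 1 - ∑ σ, s σ i) s
  have ht0 : ∀ o i, 0 ≤ t o i := by
    rintro (_ | σ) i
    · exact sub_nonneg.mpr (hs1 i)
    · exact hs0 σ i
  let W : Option (Equiv.Perm (Fin n)) → Matrix (Fin n) (Fin n) ℂ :=
    fun o => o.elim V fun σ => V.submatrix id σ
  have hW : ∀ o, (W o)ᴴ * W o = 1 := by
    rintro (_ | σ)
    · exact hV1
    · change (V.submatrix id σ)ᴴ * V.submatrix id σ = 1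
      rw [Matrix.conjTranspose_submatrix, ← Matrix.submatrix_mul _ _ _ _ _ Function.bijective_id,
        hV1, Matrix.submatrix_one_equiv]
  let K : Option (Equiv.Perm (Fin n)) → Matrix (Fin n) (Fin n) ℂ :=
    fun o => W o * D (fun i => √(t o i)) * Uᴴ
  have hKK : ∀ o, (K o)ᴴ * K o = U * D (t o) * Uᴴ := fun o => by
    rw [← hDsq _ (ht0 o)]
    simp only [K, Matrix.conjTranspose_mul, Matrix.conjTranspose_conjTranspose, hDH]
    calc U * (D (fun i => √(t o i)) * (W o)ᴴ) * (W o * D (fun i => √(t o i)) * Uᴴ)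
        = U * (D (fun i => √(t o i)) * ((W o)ᴴ * W o) * D (fun i => √(t o i))) * Uᴴ := by
          simp only [Matrix.mul_assoc]
      _ = _ := by rw [hW, Matrix.mul_one]
  have hK : ∑ o, (K o)ᴴ * K o = 1 := by
    simp_rw [hKK]
    rw [← Finset.sum_mul, ← Finset.mul_sum]
    have : ∑ o, D (t o) = 1 := by
      rw [Fintype.sum_option]
      ext i j
      rw [Matrix.add_apply, Matrix.sum_apply]
      by_cases hij : i = j
      · subst hij; simp [D, t]
      · simp [D, hij]
    rw [this, Matrix.mul_one, hU2]
  have hKA : ∀ σ, (K (some σ) * A) * (K (some σ) * A)ᴴ = (q σ * p) • (B * Bᴴ) := fun σ => by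
    have h1 : D (fun i => √(s σ i)) * D x * D (fun i => √(s σ i))
        = (q σ : ℂ) • Matrix.diagonal fun i => ((z (σ i) : ℝ) : ℂ) := by
      rw [hD, hD, ← Matrix.diagonal_smul]
      simp only [D]
      congr 1
      ext i
      simp only [Pi.mul_apply, Pi.smul_apply, smul_eq_mul]
      rw [mul_right_comm, Real.mul_self_sqrt (hs0 σ i), hsx, Complex.ofReal_mul]
    calc (K (some σ) * A) * (K (some σ) * A)ᴴ = K (some σ) * (A * Aᴴ) * (K (some σ))ᴴ := by
          simp only [Matrix.conjTranspose_mul, Matrix.mul_assoc]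
      _ = W (some σ) * (D (fun i => √(s σ i)) * (Uᴴ * (A * Aᴴ) * U) * D (fun i => √(s σ i)))
            * (W (some σ))ᴴ := by
          simp only [K, t, Matrix.conjTranspose_mul, Matrix.conjTranspose_conjTranspose, hDH,
            Matrix.mul_assoc, Option.elim]
      _ = W (some σ) * ((q σ : ℂ) • Matrix.diagonal fun i => ((z (σ i) : ℝ) : ℂ))
            * (W (some σ))ᴴ := by
          rw [conjTranspose_mul_mul_of_eq hU1 hU, h1]
      _ = (q σ : ℂ) • (p • (B * Bᴴ)) := by
          rw [Matrix.mul_smul, Matrix.smul_mul]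
          congr 1
          exact (submatrix_mul_diagonal_mul_conjTranspose V (fun i => (z i : ℂ)) σ).trans hV.symm
      _ = (q σ * p) • (B * Bᴴ) := by
          rw [mul_smul]; rfl
  have := fixedLOCCTransforms_of_measurement (B := B) (X := A) hK
    (r := fun o => o.elim 0 fun σ => q σ * p) (by
    rintro (_ | σ)
    · exact fixedLOCCTransforms_zero _ _
    · exact fixedLOCCTransforms_of_mul_conjTranspose_eq hB (mul_nonneg (hq0 σ) hp) (hKA σ))
  rw [Fintype.sum_option] at this
  simp only [Option.elim, zero_add, ← Finset.sum_mul, hq1, one_mul] at this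
  exact this

lemma FixedLOCCTransforms.loccTransforms {n m : ℕ} {A B : Matrix (Fin n) (Fin m) ℂ} {p : ℝ}
    (h : FixedLOCCTransforms A B p) : LOCCTransforms A B p :=
  let ⟨P, _, h1, h2⟩ := h
  ⟨P, h1, h2⟩

/-! ### Deterministic transformations -/

lemma sum_eigenvalues_eq_one {n m : ℕ} {A : Matrix (Fin n) (Fin m) ℂ} (hA : IsState (ket A))
    (h : (A * Aᴴ).IsHermitian) : ∑ i, h.eigenvalues i = 1 := by
  apply Complex.ofReal_injective
  have h1 := h.trace_eq_sum_eigenvalues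
  rw [← normSq_ket_eq_trace, hA] at h1
  rw [h1, Complex.ofReal_sum]
  rfl

/-- For states, whose traces agree, supermajorization is majorization. -/
lemma supermajorized_iff_majorized {n m : ℕ} {A B : Matrix (Fin n) (Fin m) ℂ}
    (hA : IsState (ket A)) (hB : IsState (ket B)) :
    Supermajorized (A * Aᴴ) (B * Bᴴ) ↔ Majorized (A * Aᴴ) (B * Bᴴ) := by
  refine exists_congr fun hX => exists_congr fun hY => ?_
  have hx := sum_eigenvalues_eq_one hA hX
  have hy := sum_eigenvalues_eq_one hB hY
  have h1 := sum_decr_lt_add_sum_decr_ge hX.eigenvalues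
  have h2 := sum_decr_lt_add_sum_decr_ge hY.eigenvalues
  constructor
  · exact fun h => ⟨fun l => by linarith [h l, h1 l, h2 l], hx.trans hy.symm⟩
  · exact fun h l => by linarith [h.1 l, h1 l, h2 l]

end PureLOCC

theorem mainTheorem1 {n m : ℕ} (A B : Matrix (Fin n) (Fin m) ℂ)
    (hA : PureLOCC.IsState (PureLOCC.ket A)) (hB : PureLOCC.IsState (PureLOCC.ket B))
    (p : ℝ) (hp0 : 0 ≤ p) (hp1 : p ≤ 1) :
    (PureLOCC.LOCCTransforms A B p ↔ PureLOCC.Supermajorized (A * Aᴴ) (p • (B * Bᴴ))) ∧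
    (PureLOCC.FixedLOCCTransforms A B p ↔ PureLOCC.Supermajorized (A * Aᴴ) (p • (B * Bᴴ))) ∧
    (0 < p → PureLOCC.LOCCTransforms A B p → B.rank ≤ A.rank) ∧
    (PureLOCC.LOCCTransforms A B 1 ↔ PureLOCC.Majorized (A * Aᴴ) (B * Bᴴ)) ∧
    (PureLOCC.FixedLOCCTransforms A B 1 ↔ PureLOCC.Majorized (A * Aᴴ) (B * Bᴴ)) ∧
    (PureLOCC.PureLOCCTransforms A B p →
      PureLOCC.Submajorized (p • (B * Bᴴ)) (A * Aᴴ)) := by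
  have h1 : ∀ r : ℝ, 0 ≤ r → (PureLOCC.LOCCTransforms A B r ↔
      PureLOCC.Supermajorized (A * Aᴴ) (r • (B * Bᴴ))) := fun r hr =>
    ⟨fun h => h.supermajorized hB hr,
      fun h => (PureLOCC.fixedLOCCTransforms_of_supermajorized hB hr h).loccTransforms⟩
  have h2 : ∀ r : ℝ, 0 ≤ r → (PureLOCC.FixedLOCCTransforms A B r ↔
      PureLOCC.Supermajorized (A * Aᴴ) (r • (B * Bᴴ))) := fun r hr =>
    ⟨fun h => h.loccTransforms.supermajorized hB hr,
      PureLOCC.fixedLOCCTransforms_of_supermajorized hB hr⟩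
  have h3 := PureLOCC.supermajorized_iff_majorized hA hB
  refine ⟨h1 p hp0, h2 p hp0, fun hp h => h.rank_le hp, ?_, ?_, fun h => h.submajorized hp0⟩
  · rw [h1 1 zero_le_one, one_smul, h3]
  · rw [h2 1 zero_le_one, one_smul, h3]
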